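/- For a compact set $E\subset\mathbb C$ let $\|f\|_E:=\sup_{z\in E}|f(z)|$, let $\mathcal P_n$ be the space of complex polynomials of degree at most $n$, and put $\operatorname{dist}_E(f,\mathcal P_n):=\inf\{\|f-p\|_E : p\in\mathcal P_n\}$. Let $\hat E:=\{z\in\mathbb C : |p(z)|\le\|p\|_E \text{ for all polynomials } p\}$ be the polynomial hull of $E$ and let $E_1:=\{z\in\mathbb C : \operatorname{dist}(z,E)\le 1\}$. Siciak's extremal function of $E$ is $$\Phi_E(z):=\limsup_{n\to\infty}\sqrt[n]{\Phi_n(z)},\qquad \Phi_n(z):=\sup\{|p(z)| : p\in\mathcal P_n,\ \|p\|_E\le 1\},\qquad z\in\mathbb C,$$ with values in $[0,\infty]$. The set $E$ is called L-regular if $\Phi_E$ is continuous on $\mathbb C$. For $\rho\ge 1$ let $C(E,\rho):=\{z\in\mathbb C : \Phi_E(z)=\rho\}$. For every L-regular compact set $E\subset\mathbb C$ there is a constant $c\ge 1$, depending only on $E$, such that for all $\zeta\in E_1\setminus\hat E$, all real $\rho$ with $1<\rho\le\Phi_E(\zeta)$ and all integers $n\ge 0$, the function $f_\zeta(z):=\frac1{\zeta-z}$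 satisfies $$\operatorname{dist}_E(f_\zeta,\mathcal P_n)\ \le\ \frac{(n+1)\,c}{\operatorname{dist}\bigl(C(E,\rho),E\bigr)\,\operatorname{dist}(\zeta,E)}\left(\frac{\rho}{\Phi_E(\zeta)}\right)^{n+1},$$ where $\operatorname{dist}(A,B):=\inf\{|a-b| : a\in A,\ b\in B\}$. -/

import Mathlib

open scoped ENNReal
open Filter

noncomputable section

namespace Siciak

/-- The supremum norm of `f` on `E`, as an extended nonnegative real. -/
def supNorm (E : Set ℂ) (f : ℂ → ℂ) : ℝ≥0∞ := ⨆ z ∈ E, ‖f z‖ₑ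

/-- The error of best uniform approximation of `f` on `E` by complex polynomials of
degree at most `n`. -/
def polyDist (E : Set ℂ) (f : ℂ → ℂ) (n : ℕ) : ℝ≥0∞ :=
  ⨅ (p : Polynomial ℂ) (_ : p.natDegree ≤ n), supNorm E (fun z => f z - p.eval z)

/-- The polynomial hull of `E`. -/
def polyHull (E : Set ℂ) : Set ℂ :=
  {z | ∀ p : Polynomial ℂ, ‖p.eval z‖ₑ ≤ supNorm E (fun w => p.eval w)}

/-- The `n`-th extremal function `Φ_n(E, ·)`. It may take the value `∞`. -/
def extremalN (E : Set ℂ) (n : ℕ) (z : ℂ) : ℝ≥0∞ :=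
  ⨆ (p : Polynomial ℂ) (_ : p.natDegree ≤ n) (_ : supNorm E (fun w => p.eval w) ≤ 1),
    ‖p.eval z‖ₑ

/-- Siciak's extremal function `Φ_E(z) = limsup_n Φ_n(E, z)^(1/n)`. -/
def extremal (E : Set ℂ) (z : ℂ) : ℝ≥0∞ :=
  limsup (fun n : ℕ => extremalN E n z ^ (1 / (n : ℝ))) atTop

/-- `E` is L-regular if its extremal function is continuous on the whole plane, as a function
into `[0, ∞]`. (For compact nonempty `E` such a function is automatically finite.) -/
def IsLRegular (E : Set ℂ) : Prop := Continuous (extremal E)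

/-- The level set `C(E, ρ) = {z | Φ_E(z) = ρ}`. -/
def levelSet (E : Set ℂ) (ρ : ℝ) : Set ℂ := {z | extremal E z = ENNReal.ofReal ρ}

/-- The distance between two nonempty sets: the infimum of the distances of their points. -/
def setDist (A B : Set ℂ) : ℝ := sInf {r : ℝ | ∃ a ∈ A, ∃ b ∈ B, r = dist a b}

end Siciak

end

open Polynomial

namespace Siciak

/-! ### The maximum principle for quotients of polynomials -/

/-! If `q` of degree at most `n` satisfies `|q| ≤ 1` on `E`, then `(q(ζ) - q(z)) / (q(ζ)(ζ - z))` is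
a polynomial approximating `1/(ζ - z)` with error `q(z) / (q(ζ)(ζ - z))`, so it suffices to make
`|q(ζ)|` large (`polyDist_le_of_eval`). Take for `q` a Lagrange basis polynomial at `n + 1` Fekete
points (`exists_fekete`). With `w` the nodal polynomial, `|L_j(z)| m_j |z - x_j| = |w(z)|`, where
`m_j = ∏_{i ≠ j} |x_j - x_i|`. Since `∑ L_j = 1`, this bounds `|w|` below on `C(E, ρ)`. The maximum
principle on `{Φ_E > ρ}`, comparing powers of normalized polynomials with powers of `w`, turns this
into a lower bound for `|w(ζ)|`, hence for `|L_j(ζ)|` with `m_j` minimal (`exists_nearly_extremal`).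
-/

/-- A quotient of polynomials vanishing at infinity obeys the maximum principle on every
set, bounded or not, whose closure contains no zero of the denominator. -/
theorem norm_eval_le_mul_of_frontier {U : Set ℂ} {P Q : ℂ[X]}
    (hdeg : P.degree < Q.degree) (hQ : ∀ z ∈ closure U, Q.eval z ≠ 0) {C : ℝ} (hC : 0 ≤ C)
    (hfr : ∀ z ∈ frontier U, ‖P.eval z‖ ≤ C * ‖Q.eval z‖) {z : ℂ} (hz : z ∈ U) :
    ‖P.eval z‖ ≤ C * ‖Q.eval z‖ := by
  have hpos : ∀ w ∈ closure U, 0 < ‖Q.eval w‖ := fun w hw => norm_pos_iff.2 (hQ w hw)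
  suffices h : ∀ ε > 0, ‖P.eval z / Q.eval z‖ ≤ C + ε by
    have := le_of_forall_pos_le_add h
    rwa [norm_div, div_le_iff₀ (hpos z (subset_closure hz))] at this
  intro ε hε
  obtain ⟨R, -, hR⟩ := (Metric.hasBasis_cobounded_compl_closedBall (0 : ℂ)).eventually_iff.1
    ((isLittleO_cobounded_of_degree_lt hdeg).def hε)
  obtain ⟨S, hS⟩ : ∃ S, max R ‖z‖ < S := exists_gt _
  have hRS : R < S := (le_max_left _ _).trans_lt hS
  have hzS : ‖z‖ < S := (le_max_right _ _).trans_lt hS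
  have hcl : closure (U ∩ Metric.ball 0 S) ⊆ closure U := closure_mono Set.inter_subset_left
  refine Complex.norm_le_of_forall_mem_frontier_norm_le (f := fun w => P.eval w / Q.eval w)
    (U := U ∩ Metric.ball 0 S) (Metric.isBounded_ball.subset Set.inter_subset_right) ?_ ?_
    (subset_closure ⟨hz, by simpa using hzS⟩)
  · refine DifferentiableOn.diffContOnCl fun w hw => ?_
    exact ((P.differentiable w).div (Q.differentiable w) (hQ w (hcl hw))).differentiableWithinAt
  · intro w hw
    have hwU : w ∈ closure U := hcl (frontier_subset_closure hw)
    rw [norm_div, div_le_iff₀ (hpos w hwU)]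
    rcases frontier_inter_subset _ _ hw with h | h
    · refine (hfr w h.1).trans ?_
      gcongr
      linarith
    · have hwS : ‖w‖ = S := by
        have := Metric.frontier_ball_subset_sphere h.2
        simpa using this
      refine (hR (by simp [hwS, hRS] : w ∈ (Metric.closedBall (0 : ℂ) R)ᶜ)).trans ?_
      gcongr
      linarith

/-! ### Elementary properties of the extremal function -/

variable {E : Set ℂ}

theorem supNorm_le_one_iff {f : ℂ → ℂ} : supNorm E f ≤ 1 ↔ ∀ z ∈ E, ‖f z‖ ≤ 1 := by
  simp only [supNorm, iSup_le_iff]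
  refine forall₂_congr fun z _ => ?_
  rw [← ofReal_norm, ENNReal.ofReal_le_one]

theorem enorm_eval_le_extremalN {p : ℂ[X]} {n : ℕ} (hp : p.natDegree ≤ n)
    (hE : ∀ z ∈ E, ‖p.eval z‖ ≤ 1) (z : ℂ) : ‖p.eval z‖ₑ ≤ extremalN E n z :=
  le_iSup_of_le p (le_iSup_of_le hp (le_iSup_of_le (supNorm_le_one_iff.2 hE) le_rfl))

theorem extremalN_le {n : ℕ} {z : ℂ} {b : ℝ}
    (h : ∀ p : ℂ[X], p.natDegree ≤ n → (∀ w ∈ E, ‖p.eval w‖ ≤ 1) → ‖p.eval z‖ ≤ b) :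
    extremalN E n z ≤ ENNReal.ofReal b := by
  refine iSup_le fun p => iSup_le fun hp => iSup_le fun hpE => ?_
  rw [← ofReal_norm]
  exact ENNReal.ofReal_le_ofReal (h p hp (supNorm_le_one_iff.1 hpE))

/-- The Bernstein-Walsh inequality for polynomials of positive degree bound. -/
theorem enorm_eval_le_extremal_pow {p : ℂ[X]} {n : ℕ} (hn : n ≠ 0) (hp : p.natDegree ≤ n)
    (hE : ∀ z ∈ E, ‖p.eval z‖ ≤ 1) (z : ℂ) : ‖p.eval z‖ₑ ≤ extremal E z ^ n := by
  have hn' : (n : ℝ) ≠ 0 := Nat.cast_ne_zero.2 hn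
  have key : ‖p.eval z‖ₑ ^ (1 / (n : ℝ)) ≤ extremal E z := by
    refine le_limsup_of_frequently_le (Filter.frequently_atTop.2 fun N => ?_)
    -- Powers of `p` stay normalized on `E`, so the bound recurs along the multiples of `n`; this
    -- suffices for a limsup.
    refine ⟨n * (N + 1), by nlinarith [Nat.pos_of_ne_zero hn], ?_⟩
    have h : ‖(p ^ (N + 1)).eval z‖ₑ ≤ extremalN E (n * (N + 1)) z := by
      refine enorm_eval_le_extremalN ?_ (fun w hw => ?_) z
      · exact natDegree_pow_le.trans (by rw [mul_comm]; gcongr)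
      · rw [eval_pow, norm_pow]
        exact pow_le_one₀ (norm_nonneg _) (hE w hw)
    refine le_trans (le_of_eq ?_) (ENNReal.rpow_le_rpow h (by positivity))
    rw [eval_pow, enorm_pow, ← ENNReal.rpow_natCast, ← ENNReal.rpow_mul]
    congr 1
    push_cast
    field_simp
  calc ‖p.eval z‖ₑ = (‖p.eval z‖ₑ ^ (1 / (n : ℝ))) ^ n := by
        rw [← ENNReal.rpow_natCast, ← ENNReal.rpow_mul, one_div_mul_cancel hn', ENNReal.rpow_one]
    _ ≤ _ := by gcongr

theorem one_le_extremal (z : ℂ) : 1 ≤ extremal E z := by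
  simpa using enorm_eval_le_extremal_pow (E := E) (p := 1) one_ne_zero (by simp) (by simp) z

/-- A geometric bound for all normalized polynomials bounds the extremal function. -/
theorem extremal_le_ofReal {z : ℂ} {B K : ℝ} (hB : 0 < B) (hK : 0 ≤ K)
    (h : ∀ n : ℕ, n ≠ 0 → ∀ p : ℂ[X], p.natDegree ≤ n → (∀ w ∈ E, ‖p.eval w‖ ≤ 1) →
      ‖p.eval z‖ ≤ B * K ^ n) :
    extremal E z ≤ ENNReal.ofReal K := by
  have hlim : Tendsto (fun n : ℕ => ENNReal.ofReal (B ^ (1 / (n : ℝ)) * K)) atTop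
      (nhds (ENNReal.ofReal K)) := by
    refine ENNReal.tendsto_ofReal ?_
    have := (tendsto_const_nhds (x := B)).rpow (tendsto_one_div_atTop_nhds_zero_nat (𝕜 := ℝ))
      (Or.inl hB.ne')
    simpa using this.mul_const K
  rw [← hlim.limsup_eq]
  refine limsup_le_limsup ?_
  filter_upwards [eventually_ne_atTop 0] with n hn
  have hn' : (n : ℝ) ≠ 0 := Nat.cast_ne_zero.2 hn
  refine (ENNReal.rpow_le_rpow (extremalN_le (h n hn)) (by positivity)).trans (le_of_eq ?_)
  rw [ENNReal.ofReal_rpow_of_nonneg (by positivity) (by positivity),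
    Real.mul_rpow hB.le (by positivity), one_div, Real.pow_rpow_inv_natCast hK hn]

theorem extremal_eq_one_of_mem {z : ℂ} (hz : z ∈ E) : extremal E z = 1 :=
  le_antisymm (by
    simpa using extremal_le_ofReal (E := E) (z := z) one_pos zero_le_one
      fun n _ p _ hp => by simpa using hp z hz) (one_le_extremal z)

/-! ### Finiteness for L-regular sets -/

/-- By continuity `Φ_E < 2` on a disc about a point `a` of `E`. Normalized polynomials are thus at
most `2 ^ n` there, and comparison with a power of `X - a` bounds their growth outside. -/
theorem extremal_ne_top (hreg : IsLRegular E) (hne : E.Nonempty) (z : ℂ) :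
    extremal E z ≠ ⊤ := by
  obtain ⟨a, ha⟩ := hne
  have hopen : IsOpen {w | extremal E w < 2} := isOpen_lt hreg continuous_const
  obtain ⟨r, hr, hball⟩ := Metric.nhds_basis_closedBall.mem_iff.1
    (hopen.mem_nhds (show extremal E a < 2 by
      rw [extremal_eq_one_of_mem ha]; exact ENNReal.one_lt_two))
  by_cases hz : z ∈ Metric.closedBall a r
  · exact (lt_trans (hball hz) ENNReal.ofNat_lt_top).ne
  have hza : r < ‖z - a‖ := by simpa [dist_eq_norm] using hz
  refine ne_top_of_le_ne_top ENNReal.ofReal_ne_top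
    (extremal_le_ofReal (E := E) (z := z) (B := ‖z - a‖ / r) (K := 2 * (‖z - a‖ / r))
      (div_pos (hr.trans hza) hr) (by positivity) fun n hn p hp hpE => ?_)
  have hbd : ∀ w ∈ Metric.closedBall a r, ‖p.eval w‖ ≤ 2 ^ n := fun w hw => by
    have h := (enorm_eval_le_extremal_pow hn hp hpE w).trans
      (pow_le_pow_left₀ zero_le (le_of_lt (hball hw)) n)
    rw [← ofReal_norm, ENNReal.ofReal_le_iff_le_toReal (by simp)] at h
    simpa using h
  have hle : ∀ w ∈ closure (Metric.closedBall a r)ᶜ, r ≤ ‖w - a‖ := by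
    refine fun w hw => closure_minimal (fun v hv => ?_)
      (isClosed_le continuous_const (by fun_prop : Continuous fun w : ℂ => ‖w - a‖)) hw
    have : r < ‖v - a‖ := by simpa [dist_eq_norm] using hv
    exact this.le
  -- The exponent `n + 1` makes the quotient vanish at infinity; its cost is the factor `B`.
  have h := norm_eval_le_mul_of_frontier (U := (Metric.closedBall a r)ᶜ) (P := p) (Q := (X - C a) ^ (n + 1))
    (C := 2 ^ n / r ^ (n + 1)) ?_ ?_ (by positivity) ?_ hz
  · refine h.trans (le_of_eq ?_)
    simp only [eval_pow, eval_sub, eval_X, eval_C, norm_pow, mul_pow, div_pow]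
    field_simp
    ring
  · rw [degree_pow, degree_X_sub_C]
    refine lt_of_le_of_lt (degree_le_of_natDegree_le hp) ?_
    simp only [nsmul_eq_mul, mul_one]
    exact_mod_cast Nat.lt_succ_self n
  · intro w hw
    have : 0 < ‖w - a‖ := hr.trans_le (hle w hw)
    simpa using fun h0 => (norm_pos_iff.1 this) h0
  · intro w hw
    have hw1 : r ≤ ‖w - a‖ := hle w (frontier_subset_closure hw)
    have hw2 : w ∈ Metric.closedBall a r := by
      rw [frontier_compl] at hw
      exact Metric.isClosed_closedBall.frontier_subset hw
    refine (hbd w hw2).trans ?_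
    simp only [eval_pow, eval_sub, eval_X, eval_C, norm_pow]
    rw [div_mul_eq_mul_div, le_div_iff₀ (by positivity)]
    gcongr

/-- On a finite set, every multiple of the nodal polynomial is normalized, which forces `Φ_E = ∞`
off the set. Infinitude supplies distinct Fekete points. -/
theorem infinite_of_extremal_ne_top {ζ : ℂ} (hζ : ζ ∉ E) (h : extremal E ζ ≠ ⊤) :
    E.Infinite := by
  intro hfin
  set q : ℂ[X] := ∏ e ∈ hfin.toFinset, (X - C e) with hq
  have hq0 : q.eval ζ ≠ 0 := by
    rw [hq, eval_prod, Finset.prod_ne_zero_iff]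
    intro e he
    have : e ∈ E := hfin.mem_toFinset.1 he
    simp only [eval_sub, eval_X, eval_C, sub_ne_zero]
    rintro rfl
    exact hζ this
  have hqE : ∀ z ∈ E, q.eval z = 0 := fun z hz => by
    rw [hq, eval_prod]
    exact Finset.prod_eq_zero (hfin.mem_toFinset.2 hz) (by simp)
  set n := q.natDegree + 1 with hn
  obtain ⟨t, ht⟩ := exists_gt (extremal E ζ ^ n).toReal
  have h1 := enorm_eval_le_extremal_pow (E := E) (p := C ((t : ℂ) / q.eval ζ) * q) (n := n)
    (by omega) ((natDegree_C_mul_le _ _).trans (by omega)) (fun z hz => by simp [hqE z hz]) ζ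
  rw [eval_mul, eval_C, div_mul_cancel₀ _ hq0, ← ofReal_norm,
    ENNReal.ofReal_le_iff_le_toReal (ENNReal.pow_ne_top h), Complex.norm_real] at h1
  exact absurd (ht.trans_le ((le_abs_self t).trans h1)) (lt_irrefl _)

/-! ### Fekete points -/

/-- Lagrange polynomials at a maximizer of the Vandermonde product are bounded by one. -/
theorem exists_fekete (hE : IsCompact E) (hinf : E.Infinite) (n : ℕ) :
    ∃ x : Fin (n + 1) → ℂ, (∀ i, x i ∈ E) ∧ Function.Injective x ∧
      ∀ j, ∀ z ∈ E, ∏ i ∈ Finset.univ.erase j, ‖z - x i‖ ≤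
        ∏ i ∈ Finset.univ.erase j, ‖x j - x i‖ := by
  classical
  -- Ordered pairs: each distance occurs twice, so the factors involving a given point form a
  -- square.
  let V : (Fin (n + 1) → ℂ) → ℝ := fun x => ∏ i, ∏ j ∈ Finset.univ.erase i, ‖x i - x j‖
  have hVc : Continuous V := by fun_prop
  have hfac : ∀ (x : Fin (n + 1) → ℂ) (j : Fin (n + 1)), V x =
      (∏ i ∈ Finset.univ.erase j, ‖x j - x i‖) ^ 2 *
        ∏ i ∈ Finset.univ.erase j, ∏ k ∈ (Finset.univ.erase i).erase j, ‖x i - x k‖ := by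
    intro x j
    have h2 : ∏ i ∈ Finset.univ.erase j, ∏ k ∈ Finset.univ.erase i, ‖x i - x k‖ =
        (∏ i ∈ Finset.univ.erase j, ‖x j - x i‖) *
          ∏ i ∈ Finset.univ.erase j, ∏ k ∈ (Finset.univ.erase i).erase j, ‖x i - x k‖ := by
      rw [← Finset.prod_mul_distrib]
      refine Finset.prod_congr rfl fun i hi => ?_
      rw [norm_sub_rev (x j) (x i)]
      exact (Finset.mul_prod_erase _ (fun k => ‖x i - x k‖)
        (Finset.mem_erase.2 ⟨(Finset.ne_of_mem_erase hi).symm, Finset.mem_univ j⟩)).symm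
    show ∏ i, ∏ k ∈ Finset.univ.erase i, ‖x i - x k‖ = _
    rw [← Finset.mul_prod_erase _ _ (Finset.mem_univ j), h2, sq, mul_assoc]
  have hpos : ∀ x : Fin (n + 1) → ℂ, Function.Injective x → 0 < V x := fun x hx =>
    Finset.prod_pos fun i _ => Finset.prod_pos fun j hj =>
      norm_pos_iff.2 (sub_ne_zero.2 (hx.ne (Finset.ne_of_mem_erase hj).symm))
  let y : Fin (n + 1) → ℂ := fun i => hinf.natEmbedding E i
  have hyE : ∀ i, y i ∈ E := fun i => (hinf.natEmbedding E i).2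
  have hyinj : Function.Injective y := fun i j hij =>
    Fin.val_injective ((hinf.natEmbedding E).injective (Subtype.ext hij))
  obtain ⟨x, hx, hmax⟩ := (isCompact_univ_pi fun _ : Fin (n + 1) => hE).exists_isMaxOn
    ⟨y, fun i _ => hyE i⟩ hVc.continuousOn
  have hVx : 0 < V x := (hpos y hyinj).trans_le (hmax fun i _ => hyE i)
  have hxinj : Function.Injective x := by
    intro i j hij
    by_contra hne
    refine hVx.ne' (Finset.prod_eq_zero (Finset.mem_univ i) (Finset.prod_eq_zero
      (Finset.mem_erase.2 ⟨Ne.symm hne, Finset.mem_univ j⟩) ?_))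
    simp [hij]
  refine ⟨x, fun i => hx i (Set.mem_univ i), hxinj, fun j z hz => ?_⟩
  -- Moving the single point `x j` to `z` cannot increase `V`.
  have hle : V (Function.update x j z) ≤ V x := by
    refine hmax fun i _ => ?_
    by_cases hi : i = j
    · subst hi; simpa using hz
    · simpa [hi] using hx i (Set.mem_univ i)
  rw [hfac x j, hfac _ j] at hle
  have h3 : ∏ i ∈ Finset.univ.erase j, ‖Function.update x j z j - Function.update x j z i‖ =
      ∏ i ∈ Finset.univ.erase j, ‖z - x i‖ := Finset.prod_congr rfl fun i hi => by
    simp [Finset.ne_of_mem_erase hi]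
  have h4 : ∏ i ∈ Finset.univ.erase j, ∏ k ∈ (Finset.univ.erase i).erase j,
      ‖Function.update x j z i - Function.update x j z k‖ =
      ∏ i ∈ Finset.univ.erase j, ∏ k ∈ (Finset.univ.erase i).erase j, ‖x i - x k‖ :=
    Finset.prod_congr rfl fun i hi => Finset.prod_congr rfl fun k hk => by
      simp [Finset.ne_of_mem_erase hi, Finset.ne_of_mem_erase hk]
  rw [h3, h4] at hle
  have h5 : 0 < ∏ i ∈ Finset.univ.erase j, ∏ k ∈ (Finset.univ.erase i).erase j, ‖x i - x k‖ := by
    rw [hfac x j] at hVx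
    exact pos_of_mul_pos_right hVx (by positivity)
  exact (sq_le_sq₀ (Finset.prod_nonneg fun _ _ => norm_nonneg _)
    (Finset.prod_nonneg fun _ _ => norm_nonneg _)).1 (le_of_mul_le_mul_right hle h5)

/-- The basic polynomials of Lagrange interpolation at Fekete points are nearly extremal. -/
theorem exists_nearly_extremal (hE : IsCompact E) (hinf : E.Infinite) (hreg : IsLRegular E)
    {ζ : ℂ} {ρ : ℝ} (hρ : 1 < ρ) (hρζ : ENNReal.ofReal ρ ≤ extremal E ζ) {d D : ℝ} (hd : 0 < d)
    (hlev : ∀ z ∈ levelSet E ρ, ∀ ξ ∈ E, d ≤ ‖z - ξ‖) (hD : ∀ ξ ∈ E, ‖ζ - ξ‖ ≤ D) (n : ℕ) :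
    ∃ q : ℂ[X], q.natDegree ≤ n ∧ (∀ z ∈ E, ‖q.eval z‖ ≤ 1) ∧
      ((extremal E ζ).toReal / ρ) ^ (n + 1) * d ≤ (n + 1) * D * ‖q.eval ζ‖ := by
  classical
  obtain ⟨x, hxE, hxinj, hfek⟩ := exists_fekete hE hinf n
  have hρ0 : 0 < ρ := zero_lt_one.trans hρ
  set m : Fin (n + 1) → ℝ := fun j => ∏ i ∈ Finset.univ.erase j, ‖x j - x i‖ with hm
  have hmpos : ∀ j, 0 < m j := fun j => Finset.prod_pos fun i hi =>
    norm_pos_iff.2 (sub_ne_zero.2 (hxinj.ne (Finset.ne_of_mem_erase hi).symm))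
  set w : ℂ[X] := ∏ i, (X - C (x i)) with hw
  have hweval : ∀ z, ‖w.eval z‖ = ∏ i, ‖z - x i‖ := fun z => by
    rw [hw, eval_prod, norm_prod]; simp
  have hwdeg : w.degree = (n + 1 : ℕ) := by
    rw [hw, degree_prod]; simp
  set L : Fin (n + 1) → ℂ[X] := fun j => Lagrange.basis Finset.univ x j with hL
  have hLm : ∀ j z, ‖(L j).eval z‖ * m j = ∏ i ∈ Finset.univ.erase j, ‖z - x i‖ := by
    intro j z
    rw [hL, hm]
    simp only [Lagrange.basis, eval_prod, norm_prod]
    rw [← Finset.prod_mul_distrib]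
    refine Finset.prod_congr rfl fun i hi => ?_
    have : ‖x j - x i‖ ≠ 0 :=
      norm_ne_zero_iff.2 (sub_ne_zero.2 (hxinj.ne (Finset.ne_of_mem_erase hi).symm))
    simp only [Lagrange.basisDivisor, eval_mul, eval_C, eval_sub, eval_X, norm_mul, norm_inv]
    field_simp
  have hLw : ∀ j z, ‖(L j).eval z‖ * m j * ‖z - x j‖ = ‖w.eval z‖ := fun j z => by
    rw [hLm, hweval, mul_comm]
    exact Finset.mul_prod_erase _ (fun i => ‖z - x i‖) (Finset.mem_univ j)
  -- Minimality of `m j₀` bounds all `|L_j|` at once in terms of `|w|`.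
  obtain ⟨j₀, hj₀⟩ := Finite.exists_min m
  set A := m j₀ with hA
  have hApos : 0 < A := hmpos j₀
  refine ⟨L j₀, ?_, fun z hz => ?_, ?_⟩
  · rw [hL]
    simp [Lagrange.natDegree_basis hxinj.injOn (Finset.mem_univ j₀)]
  · have h := hfek j₀ z hz
    rw [← hLm j₀ z] at h
    exact le_of_mul_le_mul_right (by simpa using h) hApos
  set Y : ℝ := (n + 1) / (A * d) with hY
  have hYpos : 0 < Y := by positivity
  have hlow : ∀ z ∈ levelSet E ρ, 1 ≤ Y * ‖w.eval z‖ := by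
    intro z hz
    have hsum : ∑ j, (L j).eval z = 1 := by
      rw [← eval_finsetSum, hL, Lagrange.sum_basis hxinj.injOn Finset.univ_nonempty, eval_one]
    have h1 : A * d ≤ (n + 1) * ‖w.eval z‖ := by
      calc A * d = ‖∑ j, (L j).eval z‖ * (A * d) := by rw [hsum]; simp
        _ ≤ (∑ j, ‖(L j).eval z‖) * (A * d) := by gcongr; exact norm_sum_le _ _
        _ = ∑ j, ‖(L j).eval z‖ * (A * d) := Finset.sum_mul _ _ _
        _ ≤ ∑ j : Fin (n + 1), ‖w.eval z‖ := by
          refine Finset.sum_le_sum fun j _ => ?_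
          rw [← hLw j z, mul_assoc]
          gcongr
          · exact hj₀ j
          · exact hlev z hz _ (hxE j)
        _ = _ := by simp
    rw [hY, div_mul_eq_mul_div, one_le_div (by positivity)]
    exact h1
  have hwne : ∀ z, ENNReal.ofReal ρ ≤ extremal E z → w.eval z ≠ 0 := by
    intro z hz h0
    rw [hw, eval_prod, Finset.prod_eq_zero_iff] at h0
    obtain ⟨i, -, hi⟩ := h0
    have hzi : z = x i := by simpa [sub_eq_zero] using hi
    rw [hzi, extremal_eq_one_of_mem (hxE i), ENNReal.ofReal_le_one] at hz
    exact absurd hz (not_le.2 hρ)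
  have hwζ : 0 < ‖w.eval ζ‖ := norm_pos_iff.2 (hwne ζ hρζ)
  -- With these exponents `deg p ^ (n + 1) ≤ (n + 1)N < (n + 1)(N + 1) = deg w ^ (N + 1)`, as the
  -- maximum principle requires.
  have hbdry : ∀ N : ℕ, N ≠ 0 → ∀ p : ℂ[X], p.natDegree ≤ N → (∀ z ∈ E, ‖p.eval z‖ ≤ 1) →
      ∀ z ∈ levelSet E ρ, ‖(p ^ (n + 1)).eval z‖ ≤
        (ρ ^ N) ^ (n + 1) * Y ^ (N + 1) * ‖(w ^ (N + 1)).eval z‖ := by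
    intro N hN p hp hpE z hz
    have h1 : ‖p.eval z‖ ≤ ρ ^ N := by
      have h := enorm_eval_le_extremal_pow hN hp hpE z
      rw [show extremal E z = ENNReal.ofReal ρ from hz, ← ofReal_norm,
        ← ENNReal.ofReal_pow hρ0.le] at h
      exact (ENNReal.ofReal_le_ofReal_iff (by positivity)).1 h
    rw [eval_pow, eval_pow, norm_pow, norm_pow, mul_assoc, ← mul_pow]
    calc ‖p.eval z‖ ^ (n + 1) ≤ (ρ ^ N) ^ (n + 1) := by gcongr
      _ ≤ _ := le_mul_of_one_le_right (by positivity) (one_le_pow₀ (hlow z hz))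
  set U : Set ℂ := {z | ENNReal.ofReal ρ < extremal E z} with hU
  have hUcl : closure U ⊆ {z | ENNReal.ofReal ρ ≤ extremal E z} :=
    closure_lt_subset_le continuous_const hreg
  have hUfr : frontier U ⊆ levelSet E ρ := fun z hz =>
    (frontier_lt_subset_eq continuous_const hreg hz : ENNReal.ofReal ρ = extremal E z).symm
  have hkey : ∀ N : ℕ, N ≠ 0 → ∀ p : ℂ[X], p.natDegree ≤ N → (∀ z ∈ E, ‖p.eval z‖ ≤ 1) →
      ‖(p ^ (n + 1)).eval ζ‖ ≤ (ρ ^ N) ^ (n + 1) * Y ^ (N + 1) * ‖(w ^ (N + 1)).eval ζ‖ := by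
    intro N hN p hp hpE
    rcases hρζ.eq_or_lt with h | h
    · exact hbdry N hN p hp hpE ζ h.symm
    · refine norm_eval_le_mul_of_frontier ?_ (fun z hz => ?_) (by positivity)
        (fun z hz => hbdry N hN p hp hpE z (hUfr hz)) h
      · refine (degree_le_of_natDegree_le (natDegree_pow_le.trans
          (Nat.mul_le_mul_left (n + 1) hp))).trans_lt ?_
        rw [degree_pow, hwdeg, nsmul_eq_mul]
        exact_mod_cast (by nlinarith : (n + 1) * N < (N + 1) * (n + 1))
      · rw [eval_pow]
        exact pow_ne_zero _ (hwne z (hUcl hz))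
  set T : ℝ := Y * ‖w.eval ζ‖ with hT
  have hTpos : 0 < T := mul_pos hYpos hwζ
  -- Taking `(n + 1)`-st roots gives `|p(ζ)| ≤ B (Bρ) ^ N`; the stray `B` disappears in the limit.
  set B : ℝ := T ^ (((n + 1 : ℕ) : ℝ)⁻¹) with hB
  have hBpos : 0 < B := Real.rpow_pos_of_pos hTpos _
  have hBpow : B ^ (n + 1) = T := Real.rpow_inv_natCast_pow hTpos.le (Nat.succ_ne_zero n)
  have hΦ : (extremal E ζ).toReal ≤ B * ρ := by
    refine ENNReal.toReal_le_of_le_ofReal (by positivity)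
      (extremal_le_ofReal hBpos (by positivity) fun N hN p hp hpE => ?_)
    refine le_of_pow_le_pow_left₀ n.add_one_ne_zero (by positivity) ?_
    have h := hkey N hN p hp hpE
    rw [eval_pow, norm_pow, eval_pow, norm_pow, mul_assoc, ← mul_pow, ← hT, ← hBpow] at h
    refine h.trans (le_of_eq ?_)
    ring
  have hq : ‖w.eval ζ‖ ≤ ‖(L j₀).eval ζ‖ * A * D := by
    rw [← hLw j₀ ζ]
    gcongr
    exact hD _ (hxE j₀)
  calc ((extremal E ζ).toReal / ρ) ^ (n + 1) * d ≤ B ^ (n + 1) * d := by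
        gcongr
        rwa [div_le_iff₀ hρ0]
    _ = (n + 1) * ‖w.eval ζ‖ / A := by rw [hBpow, hT, hY]; field_simp
    _ ≤ (n + 1) * (‖(L j₀).eval ζ‖ * A * D) / A := by gcongr
    _ = _ := by field_simp

/-! ### Approximation of the Cauchy kernel -/

/-- A polynomial that is small on `E` but not at `ζ` gives a good approximation of
`z ↦ 1 / (ζ - z)`. -/
theorem polyDist_le_of_eval {ζ : ℂ} {δ : ℝ} (hδ : 0 < δ) (hζ : ∀ z ∈ E, δ ≤ ‖ζ - z‖) {n : ℕ}
    {q : ℂ[X]} (hq : q.natDegree ≤ n) (hqE : ∀ z ∈ E, ‖q.eval z‖ ≤ 1) (hqζ : q.eval ζ ≠ 0) :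
    polyDist E (fun z => 1 / (ζ - z)) n ≤ ENNReal.ofReal (1 / (‖q.eval ζ‖ * δ)) := by
  set s : ℂ[X] := C (q.eval ζ)⁻¹ * (q /ₘ (X - C ζ)) with hs
  have hsd : s.natDegree ≤ n := by
    refine (natDegree_C_mul_le _ _).trans ?_
    rw [natDegree_divByMonic _ (monic_X_sub_C ζ)]
    omega
  refine (iInf₂_le s hsd).trans (iSup₂_le fun z hz => ?_)
  have hz0 : 0 < ‖ζ - z‖ := hδ.trans_le (hζ z hz)
  have hz1 : ζ - z ≠ 0 := norm_pos_iff.1 hz0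
  have hdiv : q.eval z = q.eval ζ + (z - ζ) * (q /ₘ (X - C ζ)).eval z := by
    conv_lhs => rw [← modByMonic_add_div q (X - C ζ), modByMonic_X_sub_C_eq_C_eval]
    simp
  have heq : 1 / (ζ - z) - s.eval z = q.eval z / (q.eval ζ * (ζ - z)) := by
    rw [hs, eval_mul, eval_C, hdiv]
    field_simp
    ring
  rw [← ofReal_norm]
  refine ENNReal.ofReal_le_ofReal ?_
  beta_reduce
  rw [heq, norm_div, norm_mul]
  have := norm_pos_iff.2 hqζ
  gcongr
  · exact hqE z hz
  · exact hζ z hz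

/-! ### Distances between sets -/

theorem setDist_le {A B : Set ℂ} {a b : ℂ} (ha : a ∈ A) (hb : b ∈ B) : setDist A B ≤ ‖a - b‖ :=
  csInf_le ⟨0, by rintro _ ⟨a, -, b, -, rfl⟩; exact dist_nonneg⟩
    ⟨a, ha, b, hb, (dist_eq_norm a b).symm⟩

theorem setDist_pos {A B : Set ℂ} (hA : IsClosed A) (hB : IsCompact B) (hAne : A.Nonempty)
    (hBne : B.Nonempty) (hAB : Disjoint A B) : 0 < setDist A B := by
  obtain ⟨r, hr, h⟩ := Metric.exists_pos_forall_lt_edist hB hA hAB.symm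
  obtain ⟨a, ha⟩ := hAne
  obtain ⟨b, hb⟩ := hBne
  refine (NNReal.coe_pos.2 hr).trans_le (le_csInf ⟨_, a, ha, b, hb, rfl⟩ ?_)
  rintro _ ⟨a, ha, b, hb, rfl⟩
  have hab := h b hb a ha
  rw [edist_comm, edist_nndist, ENNReal.coe_lt_coe] at hab
  exact_mod_cast hab.le

end Siciak

/-! ### The main estimate -/

theorem lemma3p3 (E : Set ℂ) (hE : IsCompact E) (hreg : Siciak.IsLRegular E) :
    ∃ c : ℝ, 1 ≤ c ∧
      ∀ ζ ∈ Metric.cthickening 1 E \ Siciak.polyHull E,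
      ∀ ρ : ℝ, 1 < ρ → ENNReal.ofReal ρ ≤ Siciak.extremal E ζ →
      ∀ n : ℕ,
        Siciak.polyDist E (fun z => 1 / (ζ - z)) n ≤
          ENNReal.ofReal
            (((n : ℝ) + 1) * c /
                (Siciak.setDist (Siciak.levelSet E ρ) E * Metric.infDist ζ E) *
              (ρ / (Siciak.extremal E ζ).toReal) ^ (n + 1)) := by
  -- This constant bounds `|ζ - ξ|` for `ζ ∈ E_1` and `ξ ∈ E`.
  refine ⟨1 + Metric.diam E, le_add_of_nonneg_right Metric.diam_nonneg, ?_⟩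
  rintro ζ ⟨hζ1, -⟩ ρ hρ hρζ n
  have hρ0 : 0 < ρ := zero_lt_one.trans hρ
  have hne : E.Nonempty := by
    rw [Set.nonempty_iff_ne_empty]
    rintro rfl
    simp at hζ1
  have hρ1 : 1 < ENNReal.ofReal ρ := ENNReal.one_lt_ofReal.2 hρ
  have hζE : ζ ∉ E := fun h =>
    absurd (hρ1.trans_le hρζ) (by rw [Siciak.extremal_eq_one_of_mem h]; exact lt_irrefl _)
  have hfin := Siciak.extremal_ne_top hreg hne ζ
  have hinf := Siciak.infinite_of_extremal_ne_top hζE hfin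
  have hlevne : (Siciak.levelSet E ρ).Nonempty := by
    obtain ⟨a, ha⟩ := hne
    -- Intermediate values between a point of `E` and `ζ`.
    exact mem_range_of_exists_le_of_exists_ge hreg
      ⟨a, by rw [Siciak.extremal_eq_one_of_mem ha]; exact hρ1.le⟩ ⟨ζ, hρζ⟩
  have hlevcl : IsClosed (Siciak.levelSet E ρ) := isClosed_eq hreg continuous_const
  have hdisj : Disjoint (Siciak.levelSet E ρ) E := by
    refine Set.disjoint_left.2 fun z hz hzE => hρ1.ne ?_
    rw [← Siciak.extremal_eq_one_of_mem hzE]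
    exact hz
  set d := Siciak.setDist (Siciak.levelSet E ρ) E with hd
  have hdpos : 0 < d := Siciak.setDist_pos hlevcl hE hlevne hne hdisj
  have hδ : 0 < Metric.infDist ζ E := (hE.isClosed.notMem_iff_infDist_pos hne).1 hζE
  have hD : ∀ ξ ∈ E, ‖ζ - ξ‖ ≤ 1 + Metric.diam E := by
    intro ξ hξ
    rw [hE.cthickening_eq_biUnion_closedBall zero_le_one] at hζ1
    obtain ⟨e, he, h1⟩ := Set.mem_iUnion₂.1 hζ1
    rw [Metric.mem_closedBall] at h1
    rw [← dist_eq_norm]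
    exact (dist_triangle ζ e ξ).trans
      (add_le_add h1 (Metric.dist_le_diam_of_mem hE.isBounded he hξ))
  obtain ⟨q, hqd, hqE, hq⟩ := Siciak.exists_nearly_extremal hE hinf hreg hρ hρζ hdpos
    (fun z hz ξ hξ => Siciak.setDist_le hz hξ) hD n
  have hΦ : 0 < (Siciak.extremal E ζ).toReal :=
    ENNReal.toReal_pos (zero_lt_one.trans_le (Siciak.one_le_extremal ζ)).ne' hfin
  have hDpos : 0 < 1 + Metric.diam E := add_pos_of_pos_of_nonneg one_pos Metric.diam_nonneg
  have hqpos : 0 < ‖q.eval ζ‖ := by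
    refine pos_of_mul_pos_right (lt_of_lt_of_le ?_ hq) (by positivity)
    positivity
  refine (Siciak.polyDist_le_of_eval hδ (fun z hz => ?_) hqd hqE (norm_pos_iff.1 hqpos)).trans
    (ENNReal.ofReal_le_ofReal ?_)
  · rw [← dist_eq_norm]
    exact Metric.infDist_le_dist_of_mem hz
  · rw [div_pow] at hq
    rw [div_pow, div_mul_div_comm, div_le_div_iff₀ (by positivity) (by positivity), one_mul]
    rw [div_mul_eq_mul_div, div_le_iff₀ (by positivity)] at hq
    nlinarith [mul_le_mul_of_nonneg_right hq hδ.le]
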